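/- Let $\mathcal P$ be the class of compact Lie groups isomorphic to a finite Cartesian product of groups of the form $SU(r)$, $U(q)$ and $Sp(k)$, where $Sp(k)$ is the group of unitary quaternionic $k\times k$ matrices. Let $G\in\mathcal P$, let $T\subset G$ be a maximal torus with Weyl group $W=N_G(T)/T$, and let $\pi$ be a finite abelian group. Give $\mathrm{Hom}(\pi,G)$ the subspace topology from $G^n$ determined by any choice of $n$ generators of $\pi$, and let $G$ act on it by conjugation. Let $W$ act on the set $\mathrm{Hom}(\pi,T)$ through its conjugation action on $T$. For $f\in\mathrm{Hom}(\pi,T)$ let \[ G_f=\{g\in G:\ g f(x)=f(x) g\ \text{ for all } x\in\pi\} \] and let $W_f\subset W$ be the stabilizer of $f$. Then for every system of representatives $f$ of the $W$-orbits $[f]$ in $\mathrm{Hom}(\pi,T)$ there is a $G$-equivariant homeomorphism \[ \Phi:\mathrm{Hom}(\pi,G)\longrightarrow \bigsqcup_{[f]\in \mathrm{Hom}(\pi,T)/W} G/G_f, \] where $G$ acts on each $G/G_f$ by left translation. Moreover, for every $f\in\mathrm{Hom}(\pi,T)$, the group $G_f$ is a maximal rank subgroup of $G$ (a closed subgroup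 that contains a maximal torus of $G$); it contains $T$, which is a maximal torus of $G_f$; and $W(G_f)=W_f$, i.e. the homomorphism $W(G_f)=N_{G_f}(T)/T\to N_G(T)/T=W$ induced by the inclusion is injective with image $W_f$. -/

import Mathlib

open scoped Quaternion

noncomputable section

namespace CommutingHom

/-! ### The class of groups -/

/-- The special unitary group `SU(r)`, with the topology of a space of complex matrices. -/
abbrev SU (r : ℕ) : Type := Matrix.specialUnitaryGroup (Fin r) ℂ

/-- The unitary group `U(q)`, with the topology of a space of complex matrices. -/
abbrev U (q : ℕ) : Type := Matrix.unitaryGroup (Fin q) ℂ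

/-- The compact symplectic group `Sp(k)`: quaternionic `k × k` matrices `A` with
`A* A = A A* = 1`, where `A*` is the conjugate transpose. -/
abbrev Sp (k : ℕ) : Type := unitary (Matrix (Fin k) (Fin k) ℍ[ℝ])

/-- `G` belongs to the class `P`: it is isomorphic, as a topological group, to a finite product
of groups `SU(r)`, `U(q)` and `Sp(k)`. -/
def IsClassP (G : Type*) [Group G] [TopologicalSpace G] : Prop :=
  ∃ (a b c : ℕ) (r : Fin a → ℕ) (q : Fin b → ℕ) (k : Fin c → ℕ),
    Nonempty (G ≃ₜ* ((∀ i, SU (r i)) × (∀ i, U (q i)) × (∀ i, Sp (k i))))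

/-! ### Maximal tori and Weyl groups -/

section Torus

variable {G : Type*} [Group G] [TopologicalSpace G]

/-- A subgroup is a torus if it is isomorphic, as a topological group, to `(S¹)ⁿ` for some `n`. -/
def IsTorus (T : Subgroup G) : Prop :=
  ∃ n : ℕ, Nonempty (T ≃ₜ* (Fin n → Circle))

/-- A maximal torus is a torus that is not properly contained in another torus. -/
def IsMaximalTorus (T : Subgroup G) : Prop :=
  Maximal IsTorus T

variable (G) in
/-- The maximal tori of `G`. -/
structure MaximalTorus where
  /-- The underlying subgroup. -/
  toSubgroup : Subgroup G
  isMaximalTorus : IsMaximalTorus toSubgroup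

/-- A maximal rank subgroup: a closed subgroup that contains a maximal torus of `G`. -/
def IsMaximalRank (H : Subgroup G) : Prop :=
  IsClosed (H : Set G) ∧ ∃ T : MaximalTorus G, T.toSubgroup ≤ H

theorem IsTorus.mul_comm {T : Subgroup G} (hT : IsTorus T) (x y : T) : x * y = y * x := by
  obtain ⟨n, ⟨e⟩⟩ := hT
  apply e.injective
  rw [map_mul, map_mul, _root_.mul_comm]

end Torus

section Weyl

variable {G : Type*} [Group G]

/-- `N_G(T) / T`; this is the Weyl group of `G` when `T` is a maximal torus of `G`. -/
abbrev WeylGroup (T : Subgroup G) : Type _ :=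
  Subgroup.normalizer (T : Set G) ⧸ T.subgroupOf (Subgroup.normalizer (T : Set G))

/-- For `T ≤ H ≤ G`, the inclusion `N_H(T) → N_G(T)`. -/
def normalizerInclusion {T H : Subgroup G} (h : T ≤ H) :
    Subgroup.normalizer (T.subgroupOf H : Set H) →* Subgroup.normalizer (T : Set G) :=
  (H.subtype.comp (Subgroup.normalizer (T.subgroupOf H : Set H)).subtype).codRestrict _ (by
    rintro ⟨x, hx⟩
    rw [Subgroup.mem_normalizer_iff] at hx ⊢
    intro t
    constructor
    · intro ht
      exact (hx ⟨t, h ht⟩).1 ht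
    · intro ht
      have htH : t ∈ H := by
        have h1 := H.mul_mem (H.mul_mem (H.inv_mem x.2) (h ht)) x.2
        simpa [mul_assoc] using h1
      exact (hx ⟨t, htH⟩).2 ht)

/-- For `T ≤ H ≤ G`, the homomorphism `N_H(T) / T → N_G(T) / T` induced by the inclusion
of `H` in `G`. -/
def weylMap {T H : Subgroup G} (h : T ≤ H) : WeylGroup (T.subgroupOf H) →* WeylGroup T :=
  QuotientGroup.map _ _ (normalizerInclusion h) (fun _ hx => hx)

end Weyl

/-! ### Spaces of homomorphisms -/

/-- The space `Hom(π, G)` of homomorphisms. -/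
def HomSpace (π G : Type*) [Group π] [Group G] : Type _ := π →* G

namespace HomSpace

section Basic

variable {π G : Type*} [Group π] [Group G]

instance : FunLike (HomSpace π G) π G := inferInstanceAs (FunLike (π →* G) π G)

instance : MonoidHomClass (HomSpace π G) π G := inferInstanceAs (MonoidHomClass (π →* G) π G)

/-- `Hom(π, G)` is topologized as a subspace of the product `G ^ π`. By
`HomSpace.topology_eq_of_closure_eq_top` this is the subspace topology from `G ^ n` given by
any `n` generators of `π`. -/
instance [TopologicalSpace G] : TopologicalSpace (HomSpace π G) :=
  TopologicalSpace.induced (fun (f : HomSpace π G) (x : π) => f x) inferInstance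

theorem topology_eq_of_closure_eq_top [TopologicalSpace G] [IsTopologicalGroup G]
    {ι : Type*} (e : ι → π) (he : Subgroup.closure (Set.range e) = ⊤) :
    (inferInstance : TopologicalSpace (HomSpace π G)) =
      TopologicalSpace.induced (fun (f : HomSpace π G) (i : ι) => f (e i)) inferInstance := by
  apply le_antisymm
  · rw [← continuous_iff_le_induced]
    exact continuous_pi fun i => (continuous_apply (e i)).comp continuous_induced_dom
  · let _ : TopologicalSpace (HomSpace π G) :=
      TopologicalSpace.induced (fun (f : HomSpace π G) (i : ι) => f (e i)) inferInstance
    refine continuous_iff_le_induced.1 (continuous_pi fun x => ?_)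
    have hx : x ∈ Subgroup.closure (Set.range e) := he ▸ Subgroup.mem_top x
    induction hx using Subgroup.closure_induction with
    | mem y hy =>
      obtain ⟨i, rfl⟩ := hy
      exact (continuous_apply i).comp
        (continuous_induced_dom (f := fun (f : HomSpace π G) (i : ι) => f (e i)))
    | one => simpa using continuous_const
    | mul y z _ _ hy hz => simpa only [map_mul] using Continuous.fun_mul hy hz
    | inv y _ hy => simpa only [map_inv] using Continuous.fun_inv hy

/-- The action of `G` on `Hom(π, G)` by conjugation: `(g • f) x = g * f x * g⁻¹`. -/
instance : MulAction G (HomSpace π G) where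
  smul g f := (MulAut.conj g).toMonoidHom.comp (f : π →* G)
  one_smul f := DFunLike.ext _ _ fun x => show 1 * f x * 1⁻¹ = f x by simp
  mul_smul g h f := DFunLike.ext _ _ fun x =>
    show g * h * f x * (g * h)⁻¹ = g * (h * f x * h⁻¹) * g⁻¹ by group

theorem smul_apply (g : G) (f : HomSpace π G) (x : π) : (g • f) x = g * f x * g⁻¹ := rfl

/-- For a subgroup `T` of `G` and `f ∈ Hom(π, T)`, the subgroup `G_f` of the elements of `G`
that commute with `f x` for all `x ∈ π`. -/
def centralizer {T : Subgroup G} (f : HomSpace π T) : Subgroup G :=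
  Subgroup.centralizer (Set.range fun x : π => (f x : G))

end Basic

end HomSpace

section WeylAction

variable {G : Type*} [Group G] [TopologicalSpace G]

/-- The action of the Weyl group `W = N_G(T) / T` on `T` by conjugation. -/
def weylConj (T : MaximalTorus G) : WeylGroup T.toSubgroup →* MulAut T.toSubgroup :=
  QuotientGroup.lift _ T.toSubgroup.normalizerMonoidHom (by
    intro n hn
    ext t
    have h := congrArg Subtype.val
      (T.isMaximalTorus.prop.mul_comm (⟨n.1, hn⟩ : T.toSubgroup) t)
    change n.1 * t.1 * n.1⁻¹ = t.1
    change n.1 * t.1 = t.1 * n.1 at h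
    rw [h, mul_inv_cancel_right])

theorem weylConj_mk (T : MaximalTorus G)
    (n : Subgroup.normalizer (T.toSubgroup : Set G)) (t : T.toSubgroup) :
    ((weylConj T (QuotientGroup.mk n) t : T.toSubgroup) : G) = n * t * (n : G)⁻¹ := rfl

/-- The action of `W` on `Hom(π, T)` induced by the action of `W` on `T`. -/
instance {π : Type*} [Group π] (T : MaximalTorus G) :
    MulAction (WeylGroup T.toSubgroup) (HomSpace π T.toSubgroup) where
  smul w f := (weylConj T w).toMonoidHom.comp (f : π →* T.toSubgroup)
  one_smul f := DFunLike.ext _ _ fun x => show weylConj T 1 (f x) = f x by simp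
  mul_smul v w f := DFunLike.ext _ _ fun x =>
    show weylConj T (v * w) (f x) = weylConj T v (weylConj T w (f x)) by simp

/-- The set `Hom(π, T) / W` of `W`-orbits in `Hom(π, T)`. -/
abbrev WeylOrbits (π : Type*) [Group π] (T : MaximalTorus G) : Type _ :=
  MulAction.orbitRel.Quotient (WeylGroup T.toSubgroup) (HomSpace π T.toSubgroup)

end WeylAction

end CommutingHom

end

/-! Two properties of a maximal torus `T` carry the decomposition of `Hom(π, G)`: every commuting
subset of `G` is conjugate into `T` (this fails for `SO(3)`), and every conjugation in `G` between
subsets of `T` is realized by an element of `N_G(T)`. By the first, each `G`-orbit in `Hom(π, G)`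
meets `Hom(π, T)`; by the second, it does so in a single `W`-orbit. Hence the orbit maps assemble
into a continuous equivariant bijection from `⊔ G/G_f` onto `Hom(π, G)`. As `π` is finite, so is
`Hom(π, T)`; the source is then compact, the target is Hausdorff, and the bijection is a
homeomorphism.

Both properties (`IsDiagonalizing`) are proved for the diagonal torus of `U(n)` and `Sp(n)` at once,
over scalars `K = ℂ` or `ℍ`. The first is simultaneous diagonalization by common eigenvectors. For
the second, Hall's theorem finds a permutation along which the entries of a unitary `g` are nonzero,
and a monomial matrix supported there conjugates the given diagonal matrices exactly as `g` does.
The properties descend to `SU(r)`, since `U(r)` is the product of its diagonal torus and `SU(r)`,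
and they pass to products and isomorphic groups. Maximality transfers them from one diagonalizing
torus to all maximal tori.

The statements on `G_f` are formal: `T` is abelian, so `T ≤ G_f`, and an element of `N_G(T)` fixes
`f` exactly when it lies in `G_f`. -/

namespace CommutingHom

/-! ### Diagonalizing subgroups, their permanence properties, and transfer to all maximal tori. -/

section Diagonalizing

/-- A subgroup `D` into which every commuting set can be conjugated, and which controls the
conjugation of its own subsets: conjugation in `G` between subsets of `D` is realized in the
normalizer of `D`. -/
structure IsDiagonalizing {G : Type*} [Group G] (D : Subgroup G) : Prop where
  exists_conj_mem (S : Set G) (hS : ∀ s ∈ S, ∀ t ∈ S, s * t = t * s) :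
    ∃ g : G, ∀ s ∈ S, g * s * g⁻¹ ∈ D
  exists_mem_normalizer (A : Set G) (hA : ∀ a ∈ A, a ∈ D) (g : G)
    (hg : ∀ a ∈ A, g * a * g⁻¹ ∈ D) :
    ∃ m ∈ Subgroup.normalizer (D : Set G), ∀ a ∈ A, m * a * m⁻¹ = g * a * g⁻¹

namespace IsDiagonalizing

theorem comap_equiv {G H : Type*} [Group G] [Group H] {D : Subgroup H} (hD : IsDiagonalizing D)
    (e : G ≃* H) : IsDiagonalizing (D.comap e.toMonoidHom) where
  exists_conj_mem S hS := by
    obtain ⟨g, hg⟩ := hD.exists_conj_mem (e '' S) (by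
      rintro _ ⟨s, hs, rfl⟩ _ ⟨t, ht, rfl⟩
      rw [← map_mul, hS s hs t ht, map_mul])
    refine ⟨e.symm g, fun s hs => ?_⟩
    simpa using hg (e s) ⟨s, hs, rfl⟩
  exists_mem_normalizer A hA g hg := by
    obtain ⟨m, hm, h⟩ := hD.exists_mem_normalizer (e '' A)
      (by rintro _ ⟨a, ha, rfl⟩; exact hA a ha) (e g) (by
        rintro _ ⟨a, ha, rfl⟩
        simpa using hg a ha)
    refine ⟨e.symm m, ?_, fun a ha => e.injective ?_⟩
    · rw [Subgroup.mem_normalizer_iff] at hm ⊢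
      intro x
      simpa using hm (e x)
    · simpa using h (e a) ⟨a, ha, rfl⟩

/-- Restriction to a subgroup, embedded by `φ`, whose product with `D` is `G`. -/
theorem comap_of_mul {G H : Type*} [Group G] [Group H] {D : Subgroup G}
    (hD : IsDiagonalizing D) (hcomm : ∀ x ∈ D, ∀ y ∈ D, x * y = y * x) (φ : H →* G)
    (hφ : Function.Injective φ)
    (hgen : ∀ g : G, ∃ t ∈ D, t * g ∈ φ.range) : IsDiagonalizing (D.comap φ) where
  exists_conj_mem S hS := by
    obtain ⟨g, hg⟩ := hD.exists_conj_mem (φ '' S) (by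
      rintro _ ⟨s, hs, rfl⟩ _ ⟨t, ht, rfl⟩
      rw [← map_mul, hS s hs t ht, map_mul])
    -- Correcting `g` by `t ∈ D` moves it into the image of `φ`, and conjugation by `t` preserves
    -- `D`.
    obtain ⟨t, ht, h, hh⟩ := hgen g
    refine ⟨h, fun s hs => ?_⟩
    have h1 := D.mul_mem (D.mul_mem ht (hg _ ⟨s, hs, rfl⟩)) (D.inv_mem ht)
    rw [Subgroup.mem_comap, map_mul, map_mul, map_inv, hh]
    simpa [mul_assoc] using h1
  exists_mem_normalizer A hA g hg := by
    obtain ⟨m, hm, h⟩ := hD.exists_mem_normalizer (φ '' A)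
      (by rintro _ ⟨a, ha, rfl⟩; exact hA a ha) (φ g) (by
        rintro _ ⟨a, ha, rfl⟩
        simpa using hg a ha)
    -- Since `D` is commutative, `t * m` conjugates `φ '' A` in the same way as `m`.
    obtain ⟨t, ht, k, hk⟩ := hgen m
    have hkN : φ k ∈ Subgroup.normalizer (D : Set G) := by
      rw [hk]; exact Subgroup.mul_mem _ (Subgroup.le_normalizer ht) hm
    refine ⟨k, ?_, fun a ha => hφ ?_⟩
    · rw [Subgroup.mem_normalizer_iff] at hkN ⊢
      intro x
      simpa using hkN (φ x)
    · have h1 := h (φ a) ⟨a, ha, rfl⟩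
      have h2 : φ g * φ a * (φ g)⁻¹ ∈ D := by simpa using hg a ha
      calc φ (k * a * k⁻¹) = t * (m * φ a * m⁻¹) * t⁻¹ := by
            simp only [map_mul, map_inv, hk]; group
        _ = φ (g * a * g⁻¹) := by
            rw [h1, hcomm t ht _ h2, mul_inv_cancel_right]; simp

theorem prod {G H : Type*} [Group G] [Group H] {D : Subgroup G} {E : Subgroup H}
    (hD : IsDiagonalizing D) (hE : IsDiagonalizing E) : IsDiagonalizing (D.prod E) where
  exists_conj_mem S hS := by
    obtain ⟨g, hg⟩ := hD.exists_conj_mem (Prod.fst '' S) (by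
      rintro _ ⟨s, hs, rfl⟩ _ ⟨t, ht, rfl⟩
      exact congrArg Prod.fst (hS s hs t ht))
    obtain ⟨h, hh⟩ := hE.exists_conj_mem (Prod.snd '' S) (by
      rintro _ ⟨s, hs, rfl⟩ _ ⟨t, ht, rfl⟩
      exact congrArg Prod.snd (hS s hs t ht))
    exact ⟨(g, h), fun s hs => ⟨hg _ ⟨s, hs, rfl⟩, hh _ ⟨s, hs, rfl⟩⟩⟩
  exists_mem_normalizer A hA g hg := by
    obtain ⟨m, hm, h⟩ := hD.exists_mem_normalizer (Prod.fst '' A)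
      (by rintro _ ⟨a, ha, rfl⟩; exact (hA a ha).1) g.1
      (by rintro _ ⟨a, ha, rfl⟩; exact (hg a ha).1)
    obtain ⟨n, hn, h'⟩ := hE.exists_mem_normalizer (Prod.snd '' A)
      (by rintro _ ⟨a, ha, rfl⟩; exact (hA a ha).2) g.2
      (by rintro _ ⟨a, ha, rfl⟩; exact (hg a ha).2)
    refine ⟨(m, n), ?_, fun a ha => Prod.ext (h _ ⟨a, ha, rfl⟩) (h' _ ⟨a, ha, rfl⟩)⟩
    rw [Subgroup.mem_normalizer_iff] at *
    exact fun x => and_congr (hm x.1) (hn x.2)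

theorem pi {ι : Type*} {G : ι → Type*} [∀ i, Group (G i)] {D : ∀ i, Subgroup (G i)}
    (hD : ∀ i, IsDiagonalizing (D i)) : IsDiagonalizing (Subgroup.pi Set.univ D) where
  exists_conj_mem S hS := by
    choose g hg using fun i => (hD i).exists_conj_mem ((fun s => s i) '' S) (by
      rintro _ ⟨s, hs, rfl⟩ _ ⟨t, ht, rfl⟩
      exact congrFun (hS s hs t ht) i)
    exact ⟨g, fun s hs i _ => hg i _ ⟨s, hs, rfl⟩⟩
  exists_mem_normalizer A hA g hg := by
    choose m hm h using fun i => (hD i).exists_mem_normalizer ((fun s => s i) '' A)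
      (by rintro _ ⟨a, ha, rfl⟩; exact hA a ha i trivial) (g i)
      (by rintro _ ⟨a, ha, rfl⟩; exact hg a ha i trivial)
    refine ⟨m, ?_, fun a ha => funext fun i => h i _ ⟨a, ha, rfl⟩⟩
    simp only [Subgroup.mem_normalizer_iff] at *
    exact fun x => forall_congr' fun i => imp_congr_right fun _ => hm i (x i)

end IsDiagonalizing

/-- The subgroup `D` is the image of a continuous injective homomorphism from `(S¹)^ι`, with `ι`
finite. -/
def IsCircleImage {G : Type*} [Group G] [TopologicalSpace G] (D : Subgroup G) : Prop :=
  ∃ (ι : Type) (_ : Fintype ι) (φ : (ι → Circle) →* G),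
    Continuous φ ∧ Function.Injective φ ∧ φ.range = D

namespace IsCircleImage

/-- A continuous bijection from the compact `(S¹)^ι` onto a Hausdorff space is a homeomorphism, so
no continuity of the inverse has to be checked for the concrete tori. -/
theorem isTorus {G : Type*} [Group G] [TopologicalSpace G] [T2Space G] {D : Subgroup G}
    (hD : IsCircleImage D) : IsTorus D := by
  obtain ⟨ι, _, φ, hφ, hinj, rfl⟩ := hD
  let e := Fintype.equivFin ι
  let ψ : (Fin (Fintype.card ι) → Circle) ≃* φ.range :=
    MulEquiv.ofBijective
      (φ.rangeRestrict.comp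
        { toFun := fun (z : Fin (Fintype.card ι) → Circle) (i : ι) => z (e i)
          map_one' := rfl
          map_mul' := fun _ _ => rfl })
      ⟨fun z w h => by
        have := hinj (congrArg Subtype.val h)
        funext i
        simpa using congrFun this (e.symm i),
      fun ⟨_, z, hz⟩ => ⟨fun i => z (e.symm i), Subtype.ext (by simpa using hz)⟩⟩
  have hψ : Continuous ψ := Continuous.subtype_mk
    (hφ.comp (continuous_pi fun i => continuous_apply (e i))) _
  refine ⟨_, ⟨ContinuousMulEquiv.symm (ContinuousMulEquiv.mk' (Continuous.homeoOfEquivCompactToT2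
    (f := ψ.toEquiv) hψ) (map_mul ψ))⟩⟩

theorem comap_equiv {G H : Type*} [Group G] [Group H] [TopologicalSpace G] [TopologicalSpace H]
    {D : Subgroup H} (hD : IsCircleImage D) (e : G ≃* H) (he : Continuous e.symm) :
    IsCircleImage (D.comap e.toMonoidHom) := by
  obtain ⟨ι, _, φ, hφ, hinj, rfl⟩ := hD
  refine ⟨ι, inferInstance, e.symm.toMonoidHom.comp φ, he.comp hφ, e.symm.injective.comp hinj, ?_⟩
  ext x
  simp [MonoidHom.mem_range, e.symm_apply_eq]

theorem prod {G H : Type*} [Group G] [Group H] [TopologicalSpace G] [TopologicalSpace H]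
    {D : Subgroup G} {E : Subgroup H} (hD : IsCircleImage D) (hE : IsCircleImage E) :
    IsCircleImage (D.prod E) := by
  obtain ⟨ι, _, φ, hφ, hinj, rfl⟩ := hD
  obtain ⟨κ, _, ψ, hψ, hinj', rfl⟩ := hE
  refine ⟨ι ⊕ κ, inferInstance,
    { toFun := fun z => (φ fun i => z (.inl i), ψ fun i => z (.inr i))
      map_one' := Prod.ext (map_one φ) (map_one ψ)
      map_mul' := fun z w => Prod.ext (map_mul φ _ _) (map_mul ψ _ _) }, ?_, ?_, ?_⟩
  · exact (hφ.comp (continuous_pi fun i => continuous_apply (Sum.inl i))).prodMk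
      (hψ.comp (continuous_pi fun i => continuous_apply (Sum.inr i)))
  · intro z w h
    have h1 := hinj (congrArg Prod.fst h)
    have h2 := hinj' (congrArg Prod.snd h)
    funext i
    cases i with
    | inl i => exact congrFun h1 i
    | inr i => exact congrFun h2 i
  · ext ⟨x, y⟩
    constructor
    · rintro ⟨z, h⟩
      exact ⟨⟨_, congrArg Prod.fst h⟩, ⟨_, congrArg Prod.snd h⟩⟩
    · rintro ⟨⟨z, hz⟩, ⟨w, hw⟩⟩
      exact ⟨Sum.elim z w, Prod.ext hz hw⟩

theorem pi {ι : Type} [Fintype ι] {G : ι → Type*} [∀ i, Group (G i)]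
    [∀ i, TopologicalSpace (G i)] {D : ∀ i, Subgroup (G i)} (hD : ∀ i, IsCircleImage (D i)) :
    IsCircleImage (Subgroup.pi Set.univ D) := by
  choose κ _ φ hφ hinj hr using hD
  refine ⟨Σ i, κ i, inferInstance,
    { toFun := fun z i => φ i fun k => z ⟨i, k⟩
      map_one' := funext fun i => map_one (φ i)
      map_mul' := fun z w => funext fun i => map_mul (φ i) _ _ }, ?_, ?_, ?_⟩
  · exact continuous_pi fun i => (hφ i).comp (continuous_pi fun k => continuous_apply _)
  · intro z w h
    funext ⟨i, k⟩
    exact congrFun (hinj i (congrFun h i)) k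
  · ext x
    constructor
    · rintro ⟨z, rfl⟩ i _
      change _ ∈ D i
      rw [← hr i]
      exact ⟨_, rfl⟩
    · intro h
      have h' : ∀ i, ∃ z, φ i z = x i := fun i => by
        have : x i ∈ D i := h i trivial
        rwa [← hr i] at this
      choose z hz using h'
      exact ⟨fun p => z p.1 p.2, funext hz⟩

end IsCircleImage

/-- If `G` has a diagonalizing torus, all its maximal tori are diagonalizing. -/
theorem MaximalTorus.isDiagonalizing {G : Type*} [Group G] [TopologicalSpace G]
    [IsTopologicalGroup G] [T2Space G] {D : Subgroup G} (hD : IsDiagonalizing D)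
    (hD' : IsCircleImage D) (T : MaximalTorus G) : IsDiagonalizing T.toSubgroup := by
  -- `T` is commutative, hence contained in a conjugate of `D`; that conjugate is a torus, so
  -- maximality forces equality.
  obtain ⟨g, hg⟩ := hD.exists_conj_mem T.toSubgroup fun s hs t ht =>
    congrArg Subtype.val (T.isMaximalTorus.prop.mul_comm ⟨s, hs⟩ ⟨t, ht⟩)
  have h := (hD'.comap_equiv (MulAut.conj g) (by
    change Continuous fun x => g⁻¹ * x * g
    fun_prop)).isTorus
  rw [T.isMaximalTorus.eq_of_le h hg]
  exact hD.comap_equiv _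

end Diagonalizing

end CommutingHom

/-! ### The scalars `ℂ` and `ℍ`, and common eigenvectors. -/

namespace CommutingHom

/-- A normed division ring with a compatible embedding of `ℂ`, over which commuting unitary matrices
can be diagonalized simultaneously with diagonal entries in `ℂ`. The instances are `ℂ` and `ℍ`. -/
class UnitaryScalars (K : Type*) [NormedDivisionRing K] [StarRing K] where
  /-- The embedding of the complex numbers. -/
  emb : ℂ →+* K
  emb_star (z : ℂ) : emb (star z) = star (emb z)
  norm_emb (z : ℂ) : ‖emb z‖ = ‖z‖
  emb_ofReal_mul (r : ℝ) (x : K) : emb r * x = x * emb r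
  mul_star_self (x : K) : x * star x = emb ((‖x‖ ^ 2 : ℝ) : ℂ)
  finite : letI := Module.compHom K emb; Module.Finite ℂ K
  -- A relation `w x = x z` with `z, w` complex determines `w` from `z`, as `z` itself or its
  -- conjugate depending on `x`. The unit `u` realizes the same rule for every `z`.
  exists_intertwiner (x : K) (hx : x ≠ 0) : ∃ (u : K) (τ : ℂ → ℂ), u * star u = 1 ∧
    Function.Involutive τ ∧ (∀ z, u * emb z = emb (τ z) * u) ∧
    ∀ z w, emb w * x = x * emb z → w = τ z

instance : UnitaryScalars ℂ where
  emb := RingHom.id ℂ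
  emb_star _ := rfl
  norm_emb _ := rfl
  emb_ofReal_mul r x := mul_comm _ _
  mul_star_self x := by
    simp [Complex.mul_conj, Complex.normSq_eq_norm_sq]
  finite := inferInstanceAs (Module.Finite ℂ ℂ)
  exists_intertwiner x hx := ⟨1, id, by simp, fun _ => rfl, by simp, fun z w h => by
    rw [mul_comm] at h; exact mul_left_cancel₀ hx h⟩

instance : UnitaryScalars ℍ[ℝ] where
  emb := Quaternion.ofComplex.toRingHom
  emb_star z := by ext <;> simp [Quaternion.coe_ofComplex]
  norm_emb z := by
    rw [← sq_eq_sq₀ (norm_nonneg _) (norm_nonneg _), sq, ← Quaternion.normSq_eq_norm_mul_self,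
      ← Complex.normSq_eq_norm_sq]
    simp [Quaternion.coe_ofComplex, Quaternion.normSq_def', Complex.normSq_apply, sq]
  emb_ofReal_mul r x := by
    simp only [Quaternion.coe_ofComplex, AlgHom.toRingHom_eq_coe, RingHom.coe_coe,
      Quaternion.coeComplex_coe]
    exact (Quaternion.coe_commutes r x)
  mul_star_self x := by
    simp only [Quaternion.coe_ofComplex, AlgHom.toRingHom_eq_coe, RingHom.coe_coe,
      Quaternion.coeComplex_coe]
    rw [Quaternion.self_mul_star, Quaternion.normSq_eq_norm_mul_self, sq]
  finite := by
    let _ := Module.compHom ℍ[ℝ] (Quaternion.ofComplex.toRingHom)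
    have _ : IsScalarTower ℝ ℂ ℍ[ℝ] := ⟨fun r z q => by
      change Quaternion.ofComplex (r • z) * q = r • (Quaternion.ofComplex z * q)
      rw [map_smul, smul_mul_assoc]⟩
    exact Module.Finite.of_restrictScalars_finite ℝ ℂ ℍ[ℝ]
  exists_intertwiner x hx := by
    -- Write `x = a + b j` with `a, b` complex. If `a = 0`, then `u = j` and `τ` is conjugation;
    -- otherwise comparing the complex parts of `w x = x z` gives `w = z`, with `u = 1`.
    by_cases h : x.re = 0 ∧ x.imI = 0
    · obtain ⟨u, h0, h1, h2, h3⟩ : ∃ u : ℍ[ℝ], u.re = 0 ∧ u.imI = 0 ∧ u.imJ = 1 ∧ u.imK = 0 :=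
        ⟨⟨0, 0, 1, 0⟩, rfl, rfl, rfl, rfl⟩
      refine ⟨u, star, ?_, star_star, ?_, ?_⟩
      · ext <;> simp [h0, h1, h2, h3]
      · intro z; ext <;> simp [Quaternion.coe_ofComplex, h0, h1, h2, h3]
      · intro z w e
        have h' : x.imJ * x.imJ + x.imK * x.imK ≠ 0 := by
          intro h0
          apply hx
          ext
          · exact h.1
          · exact h.2
          · simp; nlinarith [mul_self_nonneg x.imJ, mul_self_nonneg x.imK]
          · simp; nlinarith [mul_self_nonneg x.imJ, mul_self_nonneg x.imK]
        have e1 := congrArg QuaternionAlgebra.imJ e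
        have e2 := congrArg QuaternionAlgebra.imK e
        simp [Quaternion.coe_ofComplex, h.1, h.2] at e1 e2
        apply Complex.ext
        · apply mul_left_cancel₀ h'
          change _ * w.re = _ * z.re
          linear_combination x.imJ * e1 + x.imK * e2
        · apply mul_left_cancel₀ h'
          change _ * w.im = _ * -z.im
          linear_combination x.imJ * e2 - x.imK * e1
    · refine ⟨1, id, by simp, fun _ => rfl, by simp, ?_⟩
      intro z w e
      have h' : x.re * x.re + x.imI * x.imI ≠ 0 := by
        intro h0
        apply h
        constructor <;> nlinarith [mul_self_nonneg x.re, mul_self_nonneg x.imI]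
      have e1 := congrArg QuaternionAlgebra.re e
      have e2 := congrArg QuaternionAlgebra.imI e
      simp [Quaternion.coe_ofComplex] at e1 e2
      apply Complex.ext
      · apply mul_left_cancel₀ h'
        change _ * w.re = _ * z.re
        linear_combination x.re * e1 + x.imI * e2
      · apply mul_left_cancel₀ h'
        change _ * w.im = _ * z.im
        linear_combination x.re * e2 - x.imI * e1

/-- A commuting family of endomorphisms of a nonzero finite-dimensional complex space has a common
eigenvector. -/
theorem exists_common_eigenvector {V : Type*} [AddCommGroup V] [Module ℂ V]
    [FiniteDimensional ℂ V] {ι : Type*} (f : ι → Module.End ℂ V)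
    (hf : ∀ i j, Commute (f i) (f j)) (d : ℕ) :
    ∀ (W : Submodule ℂ V), W ≠ ⊥ → (∀ i, ∀ w ∈ W, f i w ∈ W) → Module.finrank ℂ W ≤ d →
      ∃ w ∈ W, w ≠ 0 ∧ ∀ i, ∃ μ : ℂ, f i w = μ • w := by
  induction d with
  | zero =>
    intro W hW _ h
    exact absurd (Submodule.finrank_eq_zero.1 (Nat.le_zero.1 h)) hW
  | succ d ih =>
    intro W hW hinv hd
    -- Either every `f i` is scalar on `W`, and any nonzero vector serves, or some `f i` has a
    -- proper nonzero eigenspace in `W`. The latter is stable under the whole family by commutation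
    -- and has smaller dimension.
    by_cases hs : ∀ i, ∃ μ : ℂ, ∀ w ∈ W, f i w = μ • w
    · obtain ⟨w, hw, h0⟩ := Submodule.exists_mem_ne_zero_of_ne_bot hW
      exact ⟨w, hw, h0, fun i => (hs i).imp fun μ h => h w hw⟩
    · push Not at hs
      obtain ⟨i, hi⟩ := hs
      have : Nontrivial W := Submodule.nontrivial_iff_ne_bot.2 hW
      obtain ⟨μ, hμ⟩ := Module.End.exists_eigenvalue ((f i).restrict (hinv i))
      obtain ⟨v, hv⟩ := hμ.exists_hasEigenvector
      have hvW : f i v = μ • (v : V) := congrArg Subtype.val hv.apply_eq_smul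
      obtain ⟨w, hw, hne⟩ := hi μ
      obtain ⟨x, hx, h0, hx'⟩ := ih (W ⊓ (f i).eigenspace μ)
        (fun h => hv.2 (Subtype.ext ((Submodule.eq_bot_iff _).1 h v
          ⟨v.2, Module.End.mem_eigenspace_iff.2 hvW⟩)))
        (fun j y hy => ⟨hinv j y hy.1, by
          rw [SetLike.mem_coe] at *
          rw [Module.End.mem_eigenspace_iff, ← Module.End.mul_apply, (hf i j).eq,
            Module.End.mul_apply, Module.End.mem_eigenspace_iff.1 hy.2, map_smul]⟩)
        (by
          have : W ⊓ (f i).eigenspace μ < W := lt_of_le_of_ne inf_le_left fun h =>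
            hne (Module.End.mem_eigenspace_iff.1 (h.ge hw).2)
          have := Submodule.finrank_lt_finrank_of_lt this
          omega)
      exact ⟨x, hx.1, h0, hx'⟩

end CommutingHom

/-! ### Simultaneous diagonalization of commuting unitary matrices. -/

namespace CommutingHom

open Matrix UnitaryScalars

section UnitaryDiagonalization

variable {K : Type*} [NormedDivisionRing K] [StarRing K] [UnitaryScalars K] {n : ℕ}

theorem dotProduct_star_self (w : Fin n → K) :
    w ⬝ᵥ star w = emb ((∑ i, ‖w i‖ ^ 2 : ℝ) : ℂ) := by
  simp [dotProduct, mul_star_self]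

theorem exists_smul_dotProduct_star_self_eq_one {w : Fin n → K} (hw : w ≠ 0) :
    ∃ r : ℝ, ((emb (r : ℂ) : K) • w) ⬝ᵥ star ((emb (r : ℂ) : K) • w) = 1 := by
  obtain ⟨i, hi⟩ := Function.ne_iff.1 hw
  have hpos : 0 < ∑ i, ‖w i‖ ^ 2 :=
    Finset.sum_pos' (fun i _ => by positivity) ⟨i, Finset.mem_univ i, by
      have := norm_pos_iff.2 hi; positivity⟩
  refine ⟨(√(∑ i, ‖w i‖ ^ 2))⁻¹, ?_⟩
  rw [dotProduct_star_self]
  simp only [Pi.smul_apply, smul_eq_mul, norm_mul, norm_emb, mul_pow, ← Finset.mul_sum]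
  rw [Complex.norm_real, Real.norm_eq_abs, sq_abs, inv_pow, Real.sq_sqrt hpos.le,
    inv_mul_cancel₀ hpos.ne', Complex.ofReal_one, map_one]

/-- An orthonormal family of fewer than `n` common eigenvectors of a commuting set of unitary
matrices can be enlarged. -/
theorem exists_orthogonal_eigenvector {S : Set (unitary (Matrix (Fin n) (Fin n) K))}
    (hS : ∀ s ∈ S, ∀ t ∈ S, s * t = t * s) {m : ℕ} (hm : m < n) (Q : Fin m → Fin n → K)
    (hQ : ∀ i j, Q i ⬝ᵥ star (Q j) = if i = j then 1 else 0)
    (hSQ : ∀ s ∈ S, ∀ i, ∃ μ : ℂ, Q i ᵥ* s.1 = (emb μ : K) • Q i) :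
    ∃ w : Fin n → K, w ⬝ᵥ star w = 1 ∧ (∀ i, w ⬝ᵥ star (Q i) = 0) ∧
      ∀ s ∈ S, ∃ μ : ℂ, w ᵥ* s.1 = (emb μ : K) • w := by
  -- Row vectors carry scalars on the left and matrices on the right, so `w ↦ w ᵥ* s` stays linear
  -- over the noncommutative `K`, and over `ℂ` through `emb`.
  let _ : Module ℂ K := Module.compHom K (emb (K := K))
  have _ : Module.Finite ℂ K := UnitaryScalars.finite (K := K)
  have _ : IsScalarTower ℂ K K := ⟨fun z x y => mul_assoc (emb z : K) x y⟩
  let L : (Fin n → K) →ₗ[K] (Fin m → K) :=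
    { toFun := fun w i => w ⬝ᵥ star (Q i)
      map_add' := fun v w => funext fun i => add_dotProduct _ _ _
      map_smul' := fun c w => funext fun i => smul_dotProduct _ _ _ }
  have hL : LinearMap.ker L ≠ ⊥ := LinearMap.ker_ne_bot_of_finrank_lt (by simpa using hm)
  let f : S → Module.End ℂ (Fin n → K) := fun s =>
    { toFun := fun w => w ᵥ* s.1.1
      map_add' := fun v w => add_vecMul _ _ _
      map_smul' := fun c w => smul_vecMul (emb c : K) w s.1.1 }
  have hinv : ∀ (s : S), ∀ w ∈ (LinearMap.ker L).restrictScalars ℂ,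
      f s w ∈ (LinearMap.ker L).restrictScalars ℂ := by
    intro s w hw
    have hw' : ∀ i, w ⬝ᵥ star (Q i) = 0 := fun i => congrFun hw i
    refine funext fun i => ?_
    change (w ᵥ* s.1.1) ⬝ᵥ star (Q i) = 0
    obtain ⟨μ, hμ⟩ := hSQ s.1 s.2 i
    -- By unitarity `Q i` is also an eigenvector of `star s`, with eigenvalue `μ⁻¹`. Moving `s`
    -- across the pairing therefore only multiplies it by a scalar on the right, and the orthogonal
    -- complement of the `Q i` is stable.
    have h1 : (emb μ : K) • (Q i ᵥ* star s.1.1) = Q i := by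
      rw [← smul_vecMul, ← hμ, vecMul_vecMul, Unitary.mul_star_self_of_mem s.1.2, vecMul_one]
    have h0 : (emb μ : K) ≠ 0 := by
      intro h0
      rw [h0, zero_smul] at h1
      have := hQ i i
      rw [← h1] at this
      simp at this
    have h2 : Q i ᵥ* star s.1.1 = (emb μ : K)⁻¹ • Q i := by
      conv_rhs => rw [← h1, smul_smul, inv_mul_cancel₀ h0, one_smul]
    have h3 : s.1.1 *ᵥ star (Q i) = fun k => star (Q i) k * star ((emb μ : K)⁻¹) := by
      have := congrArg star h2
      rw [star_vecMul, ← star_eq_conjTranspose, star_star] at this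
      rw [this]
      funext k
      simp
    rw [← dotProduct_mulVec, h3]
    have h4 := hw' i
    simp only [dotProduct] at h4 ⊢
    simp only [← mul_assoc, ← Finset.sum_mul, h4, zero_mul]
  obtain ⟨w, hw, hw0, hwS⟩ := exists_common_eigenvector f
    (fun s t => LinearMap.ext fun w => by
      change (w ᵥ* t.1.1) ᵥ* s.1.1 = (w ᵥ* s.1.1) ᵥ* t.1.1
      rw [vecMul_vecMul, vecMul_vecMul]
      exact congrArg (w ᵥ* ·) (congrArg Subtype.val (hS t.1 t.2 s.1 s.2)))
    _ ((LinearMap.ker L).restrictScalars ℂ)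
    (fun h => hL ((Submodule.restrictScalars_eq_bot_iff _ _ _).1 h)) hinv le_rfl
  obtain ⟨r, hr⟩ := exists_smul_dotProduct_star_self_eq_one hw0
  refine ⟨(emb (r : ℂ) : K) • w, hr, fun i => ?_, fun s hs => ?_⟩
  · have : w ⬝ᵥ star (Q i) = 0 := congrFun hw i
    rw [smul_dotProduct, this, smul_zero]
  · obtain ⟨μ, hμ⟩ := hwS ⟨s, hs⟩
    refine ⟨μ, ?_⟩
    have hμ' : w ᵥ* s.1 = (emb μ : K) • w := hμ
    rw [smul_vecMul, hμ', smul_smul, smul_smul, emb_ofReal_mul]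

theorem exists_orthonormal_eigenvectors {S : Set (unitary (Matrix (Fin n) (Fin n) K))}
    (hS : ∀ s ∈ S, ∀ t ∈ S, s * t = t * s) (m : ℕ) (hm : m ≤ n) :
    ∃ Q : Fin m → Fin n → K, (∀ i j, Q i ⬝ᵥ star (Q j) = if i = j then 1 else 0) ∧
      ∀ s ∈ S, ∀ i, ∃ μ : ℂ, Q i ᵥ* s.1 = (emb μ : K) • Q i := by
  induction m with
  | zero => exact ⟨fun i => i.elim0, fun i => i.elim0, fun _ _ i => i.elim0⟩
  | succ m ih =>
    obtain ⟨Q, hQ, hSQ⟩ := ih (by omega)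
    obtain ⟨w, hw, hwQ, hSw⟩ := exists_orthogonal_eigenvector hS hm Q hQ hSQ
    refine ⟨Fin.cons w Q, fun i j => ?_, fun s hs i => ?_⟩
    · refine Fin.cases ?_ (fun i => ?_) i <;> refine Fin.cases ?_ (fun j => ?_) j
      · simpa using hw
      · simpa [(Fin.succ_ne_zero j).symm] using hwQ j
      · have := congrArg star (hwQ i)
        rw [← star_dotProduct_star, star_star, star_zero] at this
        simpa [Fin.succ_ne_zero i] using this
      · simpa using hQ i j
    · refine Fin.cases ?_ (fun i => ?_) i
      · simpa using hSw s hs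
      · simpa using hSQ s hs i

variable (K n) in
/-- The diagonal matrices with entries in the unit circle. -/
def circleDiagonal : (Fin n → Circle) →* unitary (Matrix (Fin n) (Fin n) K) where
  toFun z := ⟨diagonal fun i => (emb (z i : ℂ) : K), by
    have h (w : Circle) : star (w : ℂ) * w = 1 ∧ (w : ℂ) * star (w : ℂ) = 1 := by
      have := Circle.coe_inv_eq_conj w
      rw [starRingEnd_apply] at this
      rw [← this]
      simp
    rw [Unitary.mem_iff, star_eq_conjTranspose, diagonal_conjTranspose, diagonal_mul_diagonal,
      diagonal_mul_diagonal]
    simp only [Pi.star_apply, ← emb_star, ← map_mul, h, map_one]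
    simp⟩
  map_one' := Subtype.ext (by
    simp only [Pi.one_apply, Circle.coe_one, map_one]
    exact diagonal_one)
  map_mul' z w := Subtype.ext (by
    simp only [Pi.mul_apply, Circle.coe_mul, map_mul]
    exact (diagonal_mul_diagonal _ _).symm)

theorem circleDiagonal_injective : Function.Injective (circleDiagonal K n) := by
  intro z w h
  funext i
  have := congrFun (diagonal_injective (congrArg Subtype.val h)) i
  exact Circle.ext (emb.injective this)

/-- Unitarity forces diagonal entries to have norm one, so only their being complex needs to be
checked. -/
theorem mem_range_circleDiagonal {s : unitary (Matrix (Fin n) (Fin n) K)} :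
    s ∈ (circleDiagonal K n).range ↔ ∃ z : Fin n → ℂ, s.1 = diagonal fun i => emb (z i) := by
  constructor
  · rintro ⟨z, rfl⟩
    exact ⟨fun i => z i, rfl⟩
  · rintro ⟨z, hz⟩
    have hu : ∀ i, ‖z i‖ = 1 := fun i => by
      have := Unitary.mul_star_self_of_mem s.2
      rw [hz, star_eq_conjTranspose, diagonal_conjTranspose, diagonal_mul_diagonal,
        ← diagonal_one] at this
      have := congrFun (diagonal_injective this) i
      rw [Pi.star_apply, mul_star_self, ← map_one (emb : ℂ →+* K)] at this
      have := emb.injective this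
      rw [norm_emb] at this
      norm_cast at this
      exact (pow_eq_one_iff_of_nonneg (norm_nonneg _) two_ne_zero).1 this
    exact ⟨fun i => ⟨z i, mem_sphere_zero_iff_norm.2 (hu i)⟩, Subtype.ext hz.symm⟩

/-- Commuting unitary matrices are simultaneously diagonalizable. -/
theorem exists_conj_mem_range_circleDiagonal {S : Set (unitary (Matrix (Fin n) (Fin n) K))}
    (hS : ∀ s ∈ S, ∀ t ∈ S, s * t = t * s) :
    ∃ g : unitary (Matrix (Fin n) (Fin n) K), ∀ s ∈ S,
      g * s * g⁻¹ ∈ (circleDiagonal K n).range := by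
  obtain ⟨Q, hQ, hSQ⟩ := exists_orthonormal_eigenvectors hS n le_rfl
  have h1 : Matrix.of Q * star (Matrix.of Q) = 1 := by
    ext i j
    rw [one_apply, ← hQ i j]
    rfl
  refine ⟨⟨Matrix.of Q, Unitary.mem_iff.2 ⟨mul_eq_one_comm.1 h1, h1⟩⟩, fun s hs => ?_⟩
  choose μ hμ using hSQ s hs
  refine mem_range_circleDiagonal.2 ⟨μ, ?_⟩
  change Matrix.of Q * s.1 * star (Matrix.of Q) = _
  have h2 : Matrix.of Q * s.1 = diagonal (fun i => emb (μ i)) * Matrix.of Q := by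
    ext i j
    rw [diagonal_mul]
    exact congrFun (hμ i) j
  rw [h2, mul_assoc, h1, mul_one]

end UnitaryDiagonalization
end CommutingHom

/-! ### Conjugation between sets of diagonal matrices is realized by monomial matrices. -/

namespace CommutingHom

open Matrix UnitaryScalars

section UnitaryFusion

variable {K : Type*} [NormedDivisionRing K] [StarRing K] [UnitaryScalars K] {n : ℕ}

theorem sum_norm_sq_row (g : unitary (Matrix (Fin n) (Fin n) K)) (i : Fin n) :
    ∑ j, ‖g.1 i j‖ ^ 2 = 1 := by
  have h0 : g.1 * star g.1 = 1 := Unitary.mul_star_self_of_mem g.2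
  have h : g.1 i ⬝ᵥ star (g.1 i) = 1 := by
    have h1 := congrFun (congrFun h0 i) i
    rwa [one_apply_eq] at h1
  rw [dotProduct_star_self, ← map_one (emb : ℂ →+* K)] at h
  exact_mod_cast emb.injective h

theorem sum_norm_sq_col [NormedStarGroup K] (g : unitary (Matrix (Fin n) (Fin n) K)) (j : Fin n) :
    ∑ i, ‖g.1 i j‖ ^ 2 = 1 := by
  simpa [star_apply] using sum_norm_sq_row (star g) j

/-- The squared norms of the entries form a doubly stochastic matrix. The rows in `s` have total
mass `s.card`, all of it in the columns that meet their support, and each column has mass one; this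
is Hall's condition. -/
theorem exists_perm_apply_ne_zero [NormedStarGroup K] (g : unitary (Matrix (Fin n) (Fin n) K)) :
    ∃ σ : Equiv.Perm (Fin n), ∀ i, g.1 i (σ i) ≠ 0 := by
  classical
  let t : Fin n → Finset (Fin n) := fun i => Finset.univ.filter fun j => g.1 i j ≠ 0
  obtain ⟨f, hf, hft⟩ := (Finset.all_card_le_biUnion_card_iff_exists_injective t).1 (fun s => by
    have h : (s.card : ℝ) ≤ (s.biUnion t).card := calc
      (s.card : ℝ) = ∑ i ∈ s, ∑ j, ‖g.1 i j‖ ^ 2 := by simp [sum_norm_sq_row]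
      _ = ∑ i ∈ s, ∑ j ∈ s.biUnion t, ‖g.1 i j‖ ^ 2 := by
        refine Finset.sum_congr rfl fun i hi =>
          (Finset.sum_subset (Finset.subset_univ _) fun j _ hj => ?_).symm
        have : g.1 i j = 0 := by
          by_contra h0
          exact hj (Finset.mem_biUnion.2 ⟨i, hi, Finset.mem_filter.2 ⟨Finset.mem_univ j, h0⟩⟩)
        simp [this]
      _ ≤ ∑ i, ∑ j ∈ s.biUnion t, ‖g.1 i j‖ ^ 2 :=
        Finset.sum_le_sum_of_subset_of_nonneg (Finset.subset_univ _)
          fun i _ _ => Finset.sum_nonneg fun j _ => by positivity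
      _ = (s.biUnion t).card := by rw [Finset.sum_comm]; simp [sum_norm_sq_col]
    exact_mod_cast h)
  exact ⟨Equiv.ofBijective f hf.bijective_of_finite, fun i => (Finset.mem_filter.1 (hft i)).2⟩

/-- If `g a = b g` with `a`, `b` diagonal, the entry at `(i, σ i)` reads `w i * x = x * z (σ i)`
with `x ≠ 0`, so `w i = τ i (z (σ i))`. The rule depends on `g` alone, so one monomial matrix, with
the unit `u i` at `(i, σ i)`, works for all `a ∈ A`. -/
theorem exists_mem_normalizer_circleDiagonal [NormedStarGroup K]
    {A : Set (unitary (Matrix (Fin n) (Fin n) K))} (hA : ∀ a ∈ A, a ∈ (circleDiagonal K n).range)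
    (g : unitary (Matrix (Fin n) (Fin n) K))
    (hg : ∀ a ∈ A, g * a * g⁻¹ ∈ (circleDiagonal K n).range) :
    ∃ m ∈ Subgroup.normalizer ((circleDiagonal K n).range : Set _),
      ∀ a ∈ A, m * a * m⁻¹ = g * a * g⁻¹ := by
  obtain ⟨σ, hσ⟩ := exists_perm_apply_ne_zero g
  choose u τ hu hτ huτ hgτ using fun i => exists_intertwiner (g.1 i (σ i)) (hσ i)
  -- Each `τ i` maps the unit circle to itself, so the monomial matrix normalizes the torus.
  have hcirc (i : Fin n) (c : Circle) : ‖τ i c‖ = 1 := by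
    have h1 := congrArg norm (huτ i c)
    have h2 : ‖u i‖ ≠ 0 := by
      intro h
      have := hu i
      rw [norm_eq_zero.1 h, zero_mul] at this
      exact zero_ne_one this
    rw [norm_mul, norm_mul, norm_emb, norm_emb, mul_comm] at h1
    rw [← mul_right_cancel₀ h2 h1, Circle.norm_coe]
  let N : Matrix (Fin n) (Fin n) K := Matrix.of fun i j => if j = σ i then u i else 0
  have hN : N * star N = 1 := by
    ext i k
    simp only [N, star_eq_conjTranspose, mul_apply, conjTranspose_apply, of_apply]
    by_cases h : i = k
    · subst h; simp [hu]
    · have : σ i ≠ σ k := fun h' => h (σ.injective h')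
      simp [h, this]
  let m : unitary (Matrix (Fin n) (Fin n) K) :=
    ⟨N, Unitary.mem_iff.2 ⟨mul_eq_one_comm.1 hN, hN⟩⟩
  have key (x y : unitary (Matrix (Fin n) (Fin n) K)) (z w : Fin n → ℂ)
      (hx : x.1 = diagonal fun i => emb (z i)) (hy : y.1 = diagonal fun i => emb (w i))
      (h : ∀ i, w i = τ i (z (σ i))) : m * x = y * m := by
    refine Subtype.ext ?_
    change N * x.1 = y.1 * N
    rw [hx, hy]
    ext i j
    rw [mul_diagonal, diagonal_mul]
    by_cases hj : j = σ i
    · subst hj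
      simp [N, huτ, h]
    · simp [N, hj]
  refine ⟨m, ?_, fun a ha => ?_⟩
  · rw [Subgroup.mem_normalizer_iff]
    refine fun x => ⟨fun hx => ?_, fun hx => ?_⟩
    · obtain ⟨z, rfl⟩ := hx
      rw [key _ (circleDiagonal K n fun i => ⟨_, mem_sphere_zero_iff_norm.2 (hcirc i (z (σ i)))⟩)
        (fun i => z i) (fun i => τ i (z (σ i))) rfl rfl fun _ => rfl, mul_inv_cancel_right]
      exact ⟨_, rfl⟩
    · obtain ⟨w, hw⟩ := hx
      -- The diagonal matrix that `m` conjugates to `w` is found by inverting the rule, using that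
      -- `τ` is involutive.
      have h := key (circleDiagonal K n fun j =>
          ⟨_, mem_sphere_zero_iff_norm.2 (hcirc (σ.symm j) (w (σ.symm j)))⟩)
        (circleDiagonal K n w)
        (fun j => τ (σ.symm j) (w (σ.symm j))) (fun i => w i) rfl rfl
        fun i => by simp [hτ i (w i)]
      rw [hw, inv_mul_cancel_right] at h
      exact ⟨_, mul_left_cancel h⟩
  · obtain ⟨z, hz⟩ := mem_range_circleDiagonal.1 (hA a ha)
    obtain ⟨w, hw⟩ := mem_range_circleDiagonal.1 (hg a ha)
    rw [mul_inv_eq_iff_eq_mul]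
    refine key _ _ z w hz hw fun i => hgτ i _ _ ?_
    have h : (g * a * g⁻¹).1 * g.1 = g.1 * a.1 := by
      change (g * a * g⁻¹ * g).1 = (g * a).1
      rw [inv_mul_cancel_right]
    rw [hw, hz] at h
    have := congrFun (congrFun h i) (σ i)
    rwa [mul_diagonal, diagonal_mul] at this

end UnitaryFusion
end CommutingHom

/-! ### Orbits in `Hom(π, G)` and the Weyl groups of centralizers. -/

namespace CommutingHom

section CompactGroup

variable {π G : Type*} [Group π] [Group G]

/-- The homomorphism to `G` underlying a homomorphism to a subgroup. -/
def HomSpace.incl {T : Subgroup G} (f : HomSpace π T) : HomSpace π G :=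
  T.subtype.comp (f : π →* T)

theorem HomSpace.mem_centralizer_iff {T : Subgroup G} {f : HomSpace π T} {g : G} :
    g ∈ f.centralizer ↔ ∀ x, g * f x * (g : G)⁻¹ = f x := by
  simp only [HomSpace.centralizer, Subgroup.mem_centralizer_iff, Set.forall_mem_range,
    mul_inv_eq_iff_eq_mul]
  exact forall_congr' fun x => eq_comm

theorem HomSpace.smul_incl_eq_incl_iff {T : Subgroup G} {f : HomSpace π T} {g : G} :
    g • f.incl = f.incl ↔ g ∈ f.centralizer := by
  rw [HomSpace.mem_centralizer_iff]
  exact DFunLike.ext_iff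

/-- The orbit map `G / G_f → Hom(π, G)` of `f`. -/
def orbitMap {T : Subgroup G} (f : HomSpace π T) : G ⧸ f.centralizer → HomSpace π G :=
  Quotient.lift (fun g : G => g • f.incl) fun a b hab => by
    have := HomSpace.smul_incl_eq_incl_iff.2 (QuotientGroup.leftRel_apply.1 hab)
    rw [mul_smul, inv_smul_eq_iff] at this
    exact this.symm

theorem orbitMap_smul {T : Subgroup G} (f : HomSpace π T) (g : G) (y : G ⧸ f.centralizer) :
    orbitMap f (g • y) = g • orbitMap f y := by
  induction y using QuotientGroup.induction_on with
  | H h => exact mul_smul g h f.incl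

variable [TopologicalSpace G]

theorem weyl_smul_eq_iff (T : MaximalTorus G) {f f' : HomSpace π T.toSubgroup}
    (n : Subgroup.normalizer (T.toSubgroup : Set G)) :
    (QuotientGroup.mk n : WeylGroup T.toSubgroup) • f = f' ↔
      ∀ x, (n : G) * f x * (n : G)⁻¹ = f' x := by
  rw [DFunLike.ext_iff]
  exact forall_congr' fun x => Subtype.ext_iff

/-- The control of conjugation, applied to the image of `f`, replaces `g` by an element of the
normalizer. This makes the orbit maps of distinct representatives have disjoint images. -/
theorem exists_weyl_smul_eq {T : MaximalTorus G} (hT : IsDiagonalizing T.toSubgroup)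
    {f f' : HomSpace π T.toSubgroup} {g : G} (h : g • f.incl = f'.incl) :
    ∃ w : WeylGroup T.toSubgroup, w • f = f' := by
  have h' : ∀ x, g * f x * g⁻¹ = f' x := DFunLike.ext_iff.1 h
  obtain ⟨m, hm, hmg⟩ := hT.exists_mem_normalizer (Set.range fun x => (f x : G))
    (by rintro _ ⟨x, rfl⟩; exact (f x).2) g
    (by rintro _ ⟨x, rfl⟩; rw [h']; exact (f' x).2)
  exact ⟨QuotientGroup.mk ⟨m, hm⟩, (weyl_smul_eq_iff T _).2 fun x =>
    (hmg _ ⟨x, rfl⟩).trans (h' x)⟩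

theorem continuous_orbitMap [IsTopologicalGroup G] {T : Subgroup G} (f : HomSpace π T) :
    Continuous (orbitMap f) := by
  refine Continuous.quotient_lift (continuous_induced_rng.2 (continuous_pi fun x => ?_)) _
  change Continuous fun g : G => g * f x * g⁻¹
  fun_prop

instance [T2Space G] : T2Space (HomSpace π G) :=
  T2Space.of_injective_continuous (f := fun (f : HomSpace π G) (x : π) => f x)
    DFunLike.coe_injective continuous_induced_dom

/-- Every value of `f` is killed by the order of `π`, so its circle coordinates are roots of unity
of that order, of which there are finitely many. -/
theorem finite_homSpace_of_isTorus [Finite π] {T : Subgroup G} (hT : IsTorus T) :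
    Finite (HomSpace π T) := by
  obtain ⟨n, ⟨e⟩⟩ := hT
  have : NeZero (Nat.card π) := ⟨Nat.card_pos.ne'⟩
  refine Finite.of_injective
    (fun (f : HomSpace π T) (x : π) (i : Fin n) =>
      (⟨Circle.toUnits (e (f x) i), by
        rw [mem_rootsOfUnity, ← map_pow, ← Pi.pow_apply, ← map_pow, ← map_pow, pow_card_eq_one']
        simp⟩ : rootsOfUnity (Nat.card π) ℂ)) ?_
  intro f f' h
  refine DFunLike.ext _ _ fun x => e.injective (funext fun i => ?_)
  have := congrArg Units.val (congrArg Subtype.val (congrFun (congrFun h x) i))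
  exact Circle.ext this

/-- The decomposition of `Hom(π, G)` into orbits, for a compact group with a diagonalizing
maximal torus. -/
theorem exists_equivariant_homeomorph {π : Type*} [CommGroup π] [Finite π] [IsTopologicalGroup G]
    [T2Space G] [CompactSpace G] {T : MaximalTorus G} (hT : IsDiagonalizing T.toSubgroup)
    (rep : WeylOrbits π T → HomSpace π T.toSubgroup) (hrep : ∀ o, Quotient.mk _ (rep o) = o) :
    ∃ Φ : HomSpace π G ≃ₜ (Σ o : WeylOrbits π T, G ⧸ (rep o).centralizer),
      ∀ (g : G) (f : HomSpace π G), Φ (g • f) = g • Φ f := by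
  have := finite_homSpace_of_isTorus (π := π) T.isMaximalTorus.prop
  let Ψ : (Σ o : WeylOrbits π T, G ⧸ (rep o).centralizer) → HomSpace π G :=
    fun p => orbitMap (rep p.1) p.2
  have hΨ : Continuous Ψ := continuous_sigma fun o => continuous_orbitMap (rep o)
  have hinj : Function.Injective Ψ := by
    rintro ⟨o, y⟩ ⟨o', y'⟩ h
    induction y using QuotientGroup.induction_on with | H g => ?_
    induction y' using QuotientGroup.induction_on with | H g' => ?_
    have h1 : g • (rep o).incl = g' • (rep o').incl := h
    have h2 : (g'⁻¹ * g) • (rep o).incl = (rep o').incl := by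
      rw [mul_smul, h1, inv_smul_smul]
    obtain ⟨w, hw⟩ := exists_weyl_smul_eq hT h2
    have ho : o' = o := by
      rw [← hrep o, ← hrep o']
      exact Quotient.sound ⟨w, hw⟩
    subst ho
    congr 1
    exact (QuotientGroup.eq.2 (HomSpace.smul_incl_eq_incl_iff.1 h2)).symm
  have hsurj : Function.Surjective Ψ := by
    intro f
    obtain ⟨g, hg⟩ := hT.exists_conj_mem (Set.range f) (by
      rintro _ ⟨x, rfl⟩ _ ⟨y, rfl⟩
      rw [← map_mul, mul_comm, map_mul])
    -- `f` is first conjugated into `T`, then moved by an element `n` of the normalizer to the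
    -- chosen representative of its `W`-orbit.
    let k : HomSpace π T.toSubgroup := MonoidHom.codRestrict ((g • f : HomSpace π G) : π →* G)
      T.toSubgroup fun x => hg _ ⟨x, rfl⟩
    have hk : k.incl = g • f := rfl
    obtain ⟨w, hw⟩ : ∃ w : WeylGroup T.toSubgroup, w • k = rep (Quotient.mk _ k) :=
      Quotient.exact (hrep (Quotient.mk _ k))
    induction w using QuotientGroup.induction_on with | H n => ?_
    have hn : (n : G) • k.incl = (rep (Quotient.mk _ k)).incl :=
      DFunLike.ext _ _ ((weyl_smul_eq_iff T n).1 hw)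
    refine ⟨⟨Quotient.mk _ k, QuotientGroup.mk (g⁻¹ * (n : G)⁻¹)⟩, ?_⟩
    change (g⁻¹ * (n : G)⁻¹) • (rep (Quotient.mk _ k)).incl = f
    rw [← hn, hk, mul_smul, inv_smul_smul, inv_smul_smul]
  -- The source is compact as a finite disjoint union of quotients of `G`; finiteness of `Hom(π, T)`
  -- is used here.
  let e := Continuous.homeoOfEquivCompactToT2 (f := Equiv.ofBijective Ψ ⟨hinj, hsurj⟩) hΨ
  refine ⟨e.symm, fun g f => ?_⟩
  rw [Homeomorph.symm_apply_eq]
  have h : e (g • e.symm f) = g • e (e.symm f) := orbitMap_smul _ g _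
  rw [h, e.apply_symm_apply]

/-- The Weyl group of the centralizer of `f` is the stabilizer of `f`. -/
theorem centralizer_maximalRank {π : Type*} [Group π] [IsTopologicalGroup G] [T2Space G]
    (T : MaximalTorus G) (f : HomSpace π T.toSubgroup) :
    IsMaximalRank f.centralizer ∧ ∃ h : T.toSubgroup ≤ f.centralizer,
      IsMaximalTorus (T.toSubgroup.subgroupOf f.centralizer) ∧
      Function.Injective (weylMap h) ∧
      (weylMap h).range = MulAction.stabilizer (WeylGroup T.toSubgroup) f := by
  have h : T.toSubgroup ≤ f.centralizer := fun t ht => by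
    rw [HomSpace.mem_centralizer_iff]
    intro x
    rw [mul_inv_eq_iff_eq_mul]
    exact congrArg Subtype.val (T.isMaximalTorus.prop.mul_comm ⟨t, ht⟩ (f x))
  refine ⟨⟨Set.isClosed_centralizer _, T, h⟩, h, ⟨?_, ?_⟩, ?_, ?_⟩
  · obtain ⟨n, ⟨e⟩⟩ := T.isMaximalTorus.prop
    let i : T.toSubgroup.subgroupOf f.centralizer ≃ₜ* T.toSubgroup :=
      { Subgroup.subgroupOfEquivOfLe h with
        continuous_toFun := Continuous.subtype_mk
          (continuous_subtype_val.comp continuous_subtype_val) _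
        continuous_invFun := Continuous.subtype_mk
          (Continuous.subtype_mk continuous_subtype_val _) _ }
    exact ⟨n, ⟨i.trans e⟩⟩
  · intro S hS hTS
    obtain ⟨n, ⟨e⟩⟩ := hS
    -- A torus of `G_f` is also a torus of `G`, so maximality of `T` in `G` gives maximality in
    -- `G_f`.
    have hmap : IsTorus (S.map f.centralizer.subtype) := by
      let i : S.map f.centralizer.subtype ≃ₜ* S :=
        { (S.equivMapOfInjective _ f.centralizer.subtype_injective).symm with
          continuous_toFun := by
            refine continuous_induced_rng.2 (continuous_induced_rng.2 ?_)
            refine continuous_subtype_val.congr fun x => ?_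
            exact congrArg Subtype.val ((S.equivMapOfInjective _
              f.centralizer.subtype_injective).apply_symm_apply x).symm
          continuous_invFun := Continuous.subtype_mk
            (continuous_subtype_val.comp continuous_subtype_val) _ }
      exact ⟨n, ⟨i.trans e⟩⟩
    have hle := T.isMaximalTorus.le_of_ge hmap
      (fun t ht => ⟨⟨t, h ht⟩, hTS ht, rfl⟩)
    exact fun s hs => hle ⟨s, hs, rfl⟩
  · rw [injective_iff_map_eq_one]
    intro w hw
    induction w using QuotientGroup.induction_on with | H n => ?_
    rw [QuotientGroup.eq_one_iff]
    exact (QuotientGroup.eq_one_iff (normalizerInclusion h n)).1 hw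
  · ext w
    constructor
    · rintro ⟨v, rfl⟩
      induction v using QuotientGroup.induction_on with | H n => ?_
      exact (weyl_smul_eq_iff T (normalizerInclusion h n)).2
        (HomSpace.mem_centralizer_iff.1 n.1.2)
    · intro hw
      induction w using QuotientGroup.induction_on with | H n => ?_
      -- A representative `n` of a class fixing `f` already lies in `G_f`, so it is its own lift to
      -- `N_{G_f}(T)`.
      have hn : (n : G) ∈ f.centralizer := HomSpace.mem_centralizer_iff.2
        ((weyl_smul_eq_iff T n).1 hw)
      refine ⟨QuotientGroup.mk ⟨⟨n, hn⟩, ?_⟩, rfl⟩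
      rw [Subgroup.mem_normalizer_iff]
      exact fun x => Subgroup.mem_normalizer_iff.1 n.2 x

end CompactGroup
end CommutingHom

/-! ### Diagonal tori and compactness of `U(n)`, `Sp(n)` and `SU(r)`. -/

namespace CommutingHom

open Matrix UnitaryScalars

section ClassicalGroups

variable {K : Type*} [NormedDivisionRing K] [StarRing K] [UnitaryScalars K] {n : ℕ}

theorem continuous_circleDiagonal : Continuous (circleDiagonal K n) := by
  have hemb : Continuous (emb : ℂ →+* K) :=
    (AddMonoidHomClass.isometry_of_norm _ norm_emb).continuous
  refine Continuous.subtype_mk (Continuous.matrix_diagonal (continuous_pi fun i => ?_)) _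
  exact hemb.comp (continuous_subtype_val.comp (continuous_apply i))

theorem isCircleImage_circleDiagonal : IsCircleImage (circleDiagonal K n).range :=
  ⟨Fin n, inferInstance, circleDiagonal K n, continuous_circleDiagonal, circleDiagonal_injective,
    rfl⟩

variable (K n) in
theorem isDiagonalizing_circleDiagonal [NormedStarGroup K] :
    IsDiagonalizing (circleDiagonal K n).range :=
  ⟨fun _ => exists_conj_mem_range_circleDiagonal, fun _ => exists_mem_normalizer_circleDiagonal⟩

variable (K n) in
theorem isCompact_unitary_matrix [NormedStarGroup K] [ProperSpace K] :
    IsCompact (unitary (Matrix (Fin n) (Fin n) K) : Set (Matrix (Fin n) (Fin n) K)) := by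
  have hcl : IsClosed (unitary (Matrix (Fin n) (Fin n) K) : Set (Matrix (Fin n) (Fin n) K)) :=
    isClosed_unitary
  have hK : IsCompact (Set.univ.pi fun _ : Fin n => Set.univ.pi fun _ : Fin n =>
      Metric.closedBall (0 : K) 1) :=
    isCompact_univ_pi fun _ => isCompact_univ_pi fun _ => isCompact_closedBall _ _
  -- Each row has norm one, so every entry lies in the closed unit ball.
  refine hK.of_isClosed_subset hcl fun A hA i _ j _ => ?_
  rw [mem_closedBall_zero_iff, ← sq_le_one_iff₀ (norm_nonneg _), ← sum_norm_sq_row ⟨A, hA⟩ i]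
  exact Finset.single_le_sum (f := fun j => ‖A i j‖ ^ 2) (fun j _ => by positivity)
    (Finset.mem_univ j)

instance [NormedStarGroup K] [ProperSpace K] :
    CompactSpace (unitary (Matrix (Fin n) (Fin n) K)) :=
  isCompact_iff_compactSpace.1 (isCompact_unitary_matrix K n)

instance : ProperSpace ℍ[ℝ] := FiniteDimensional.proper ℝ ℍ[ℝ]

instance (r : ℕ) : CompactSpace (SU r) := by
  refine isCompact_iff_compactSpace.1 ?_
  exact (isCompact_unitary_matrix ℂ r).inter_right
    (isClosed_eq (f := fun A : Matrix (Fin r) (Fin r) ℂ => A.det)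
      (Continuous.matrix_det continuous_id) continuous_const)

instance (r : ℕ) : IsTopologicalGroup (SU r) where
  continuous_inv := Continuous.subtype_mk (continuous_star.comp continuous_subtype_val) _

/-- The inclusion of `SU(r)` in `U(r)`. -/
def specialUnitaryInclusion (r : ℕ) : SU r →* U r :=
  Submonoid.inclusion specialUnitaryGroup_le_unitaryGroup

theorem mem_range_specialUnitaryInclusion {r : ℕ} {g : U r} :
    g ∈ (specialUnitaryInclusion r).range ↔ g.1.det = 1 :=
  ⟨by rintro ⟨s, rfl⟩; exact (mem_specialUnitaryGroup_iff.1 s.2).2,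
    fun h => ⟨⟨g.1, mem_specialUnitaryGroup_iff.2 ⟨g.2, h⟩⟩, rfl⟩⟩

theorem specialUnitaryInclusion_injective (r : ℕ) :
    Function.Injective (specialUnitaryInclusion r) :=
  Submonoid.inclusion_injective specialUnitaryGroup_le_unitaryGroup

theorem det_circleDiagonal {r : ℕ} (z : Fin r → Circle) :
    (circleDiagonal ℂ r z).1.det = ((∏ i, z i : Circle) : ℂ) := by
  change (diagonal fun i => (z i : ℂ)).det = _
  rw [det_diagonal]
  exact (map_prod Circle.coeHom z Finset.univ).symm

theorem isDiagonalizing_specialUnitary (r : ℕ) :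
    IsDiagonalizing ((circleDiagonal ℂ r).range.comap (specialUnitaryInclusion r)) := by
  refine (isDiagonalizing_circleDiagonal ℂ r).comap_of_mul ?_ _
    (specialUnitaryInclusion_injective r) fun g => ?_
  · rintro _ ⟨z, rfl⟩ _ ⟨w, rfl⟩
    rw [← map_mul, mul_comm, map_mul]
  · cases r with
    -- For `r = 0` there is no diagonal entry to adjust, but the determinant is already one.
    | zero => exact ⟨1, one_mem _, mem_range_specialUnitaryInclusion.2 (det_fin_zero)⟩
    | succ r =>
      let d : Circle := ⟨g.1.det, by
        have := det_of_mem_unitary g.2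
        exact mem_sphere_zero_iff_norm.2 (CStarRing.norm_of_mem_unitary this)⟩
      -- The matrix `diag(d⁻¹, 1, …, 1)`, with `d = det g`, corrects the determinant to one.
      refine ⟨circleDiagonal ℂ _ (Pi.mulSingle 0 d⁻¹), ⟨_, rfl⟩,
        mem_range_specialUnitaryInclusion.2 ?_⟩
      change ((circleDiagonal ℂ _ (Pi.mulSingle 0 d⁻¹)).1 * g.1).det = 1
      rw [det_mul, det_circleDiagonal, Finset.prod_pi_mulSingle' 0 d⁻¹, if_pos (Finset.mem_univ _)]
      change ((d⁻¹ : Circle) : ℂ) * (d : ℂ) = 1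
      rw [← Circle.coe_mul, inv_mul_cancel, Circle.coe_one]

/-- On the diagonal torus the determinant condition expresses the first entry as the inverse of the
product of the others, which are free; the rank is `r - 1` for `r > 0`. -/
theorem isCircleImage_specialUnitary (r : ℕ) :
    IsCircleImage ((circleDiagonal ℂ r).range.comap (specialUnitaryInclusion r)) := by
  cases r with
  | zero =>
    refine ⟨Fin 0, inferInstance, 1, continuous_const, Function.injective_of_subsingleton _, ?_⟩
    exact Subgroup.ext fun x => by
      have : x = 1 := Subtype.ext (Subsingleton.elim _ _)
      rw [this]
      exact ⟨fun _ => one_mem _, fun _ => one_mem _⟩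
  | succ r =>
    let ψ : (Fin r → Circle) →* (Fin (r + 1) → Circle) :=
      { toFun := fun z => Fin.cons (∏ i, z i)⁻¹ z
        map_one' := by
          funext i
          refine Fin.cases ?_ (fun i => ?_) i <;> simp
        map_mul' := fun z w => by
          funext i
          refine Fin.cases ?_ (fun i => ?_) i
          · simp [Finset.prod_mul_distrib, mul_comm]
          · simp }
    have hψ : Continuous ψ := by
      refine continuous_pi fun i => Fin.cases ?_ (fun i => ?_) i
      · change Continuous fun z : Fin r → Circle => (∏ i, z i)⁻¹
        fun_prop
      · exact continuous_apply i
    have hdet (z) : (circleDiagonal ℂ (r + 1) (ψ z)).1.det = 1 := by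
      rw [det_circleDiagonal, Fin.prod_univ_succ]
      simp [ψ]
    let φ : (Fin r → Circle) →* SU (r + 1) :=
      { toFun := fun z => ⟨(circleDiagonal ℂ (r + 1) (ψ z)).1,
          mem_specialUnitaryGroup_iff.2 ⟨(circleDiagonal ℂ (r + 1) (ψ z)).2, hdet z⟩⟩
        map_one' := Subtype.ext (congrArg (Subtype.val : U (r + 1) → _)
          (map_one ((circleDiagonal ℂ (r + 1)).comp ψ)))
        map_mul' := fun z w => Subtype.ext (congrArg (Subtype.val : U (r + 1) → _)
          (map_mul ((circleDiagonal ℂ (r + 1)).comp ψ) z w)) }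
    refine ⟨Fin r, inferInstance, φ, ?_, ?_, ?_⟩
    · exact Continuous.subtype_mk (continuous_subtype_val.comp
        (continuous_circleDiagonal.comp hψ)) _
    · intro z w h
      have := circleDiagonal_injective (K := ℂ) (Subtype.ext (congrArg (Subtype.val : SU (r + 1) → _) h) :
        circleDiagonal ℂ (r + 1) (ψ z) = circleDiagonal ℂ (r + 1) (ψ w))
      funext i
      exact congrFun this i.succ
    · ext x
      constructor
      · rintro ⟨z, rfl⟩
        exact ⟨ψ z, rfl⟩
      · rintro ⟨z, hz⟩
        have h1 : ∏ i, z i = 1 := by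
          have := mem_range_specialUnitaryInclusion.1 ⟨x, rfl⟩
          rw [← hz, det_circleDiagonal] at this
          exact Circle.ext this
        refine ⟨fun i => z i.succ, specialUnitaryInclusion_injective _ ?_⟩
        rw [← hz]
        change circleDiagonal ℂ (r + 1) (ψ fun i => z i.succ) = _
        congr 1
        funext i
        refine Fin.cases ?_ (fun i => ?_) i
        · rw [Fin.prod_univ_succ] at h1
          exact (eq_inv_of_mul_eq_one_left h1).symm
        · rfl

end ClassicalGroups

end CommutingHom

/-! ### Assembly for the class `P` and the main theorem. -/

open CommutingHom in
theorem CommutingHom.IsClassP.exists_isDiagonalizing {G : Type*} [Group G] [TopologicalSpace G]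
    (hG : IsClassP G) : IsTopologicalGroup G ∧ T2Space G ∧ CompactSpace G ∧
      ∃ D : Subgroup G, IsDiagonalizing D ∧ IsCircleImage D := by
  obtain ⟨a, b, c, r, q, k, ⟨e⟩⟩ := hG
  refine ⟨e.isInducing.topologicalGroup e, e.symm.toHomeomorph.t2Space,
    e.symm.toHomeomorph.compactSpace, ?_⟩
  exact ⟨_, IsDiagonalizing.comap_equiv
      ((IsDiagonalizing.pi fun i => isDiagonalizing_specialUnitary (r i)).prod
        ((IsDiagonalizing.pi fun i => isDiagonalizing_circleDiagonal ℂ (q i)).prod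
          (IsDiagonalizing.pi fun i => isDiagonalizing_circleDiagonal ℍ[ℝ] (k i)))) e.toMulEquiv,
    IsCircleImage.comap_equiv
      ((IsCircleImage.pi fun i => isCircleImage_specialUnitary (r i)).prod
        ((IsCircleImage.pi fun i => isCircleImage_circleDiagonal).prod
          (IsCircleImage.pi fun i => isCircleImage_circleDiagonal))) e.toMulEquiv
      e.symm.continuous⟩

theorem mainTheorem6 {π : Type*} [CommGroup π] [Finite π]
    {G : Type*} [Group G] [TopologicalSpace G] (hG : CommutingHom.IsClassP G)
    (T : CommutingHom.MaximalTorus G) :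
    -- for every system `rep` of representatives of the `W`-orbits
    (∀ rep : CommutingHom.WeylOrbits π T → CommutingHom.HomSpace π T.toSubgroup,
      (∀ o, Quotient.mk _ (rep o) = o) →
      ∃ Φ : CommutingHom.HomSpace π G ≃ₜ
          (Σ o : CommutingHom.WeylOrbits π T, G ⧸ (rep o).centralizer),
        ∀ (g : G) (f : CommutingHom.HomSpace π G), Φ (g • f) = g • Φ f) ∧
    -- `G_f` has maximal rank, with Weyl group `W_f`
    (∀ f : CommutingHom.HomSpace π T.toSubgroup,
      CommutingHom.IsMaximalRank f.centralizer ∧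
      ∃ h : T.toSubgroup ≤ f.centralizer,
        CommutingHom.IsMaximalTorus (T.toSubgroup.subgroupOf f.centralizer) ∧
        Function.Injective (CommutingHom.weylMap h) ∧
        (CommutingHom.weylMap h).range =
          MulAction.stabilizer (CommutingHom.WeylGroup T.toSubgroup) f) := by
  obtain ⟨_, _, _, D, hD, hD'⟩ := hG.exists_isDiagonalizing
  exact ⟨CommutingHom.exists_equivariant_homeomorph (T.isDiagonalizing hD hD'),
    CommutingHom.centralizer_maximalRank T⟩
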